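/- Let $s, C > 0$ be constants and let $c:\mathbb{R}\to\mathbb{R}$ be a continuous cost function such that $c(x)\ge 0$ for all $x$, $c(0)=0$, $c(x)=c(-x)$ for all $x$, $c(x)\le c(x')$ whenever $|x|\le |x'|$, and $c(x)\sim\beta x^{\alpha}$ as $x\to\infty$ for some $\alpha,\beta>0$. Let $D(P\|Q)\in[0,\infty]$ denote the Kullback--Leibler divergence. Let $\mathscr{P}$ be the set of all Markov kernels $P_{Y|X}$ from $\mathbb{R}$ to $\mathbb{R}$ (with the Borel $\sigma$-algebra) such that $$\sup_{x\in\mathbb{R}} \mathbb{E}[c(Y-x)\mid X=x] = \sup_{x\in\mathbb{R}} \int_{\mathbb{R}} c(y-x)\,P_{Y|X=x}(dy)\le C,$$ and put $$\mathrm{KL}^\star := \inf_{P_{Y|X}\in\mathscr{P}}\ \sup_{x,x'\in\mathbb{R}:\,|x-x'|\le s} D(P_{Y|X=x}\,\|\,P_{Y|X=x'}).$$ Let $\mathscr{P}_{\mathrm{add}}$ be the set of Borel probability measures $P$ on $\mathbb{R}$ with $\mathbb{E}_P[c]\le C$ (the laws of the noise $Z$ in additive mechanisms $Y=X+Z$,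 with $Z$ independent of $X$), let $(T_aP)(B):=P(B-a)$ denote the shift of $P$ by $a$, and put $$\mathrm{KL}^\star_{\mathrm{add}} := \inf_{P\in\mathscr{P}_{\mathrm{add}}}\ \sup_{a\in\mathbb{R}:\,|a|\le s} D(P\,\|\,T_aP).$$ Then $\mathrm{KL}^\star=\mathrm{KL}^\star_{\mathrm{add}}$, and there exists $P^\star\in\mathscr{P}_{\mathrm{add}}$ with $\sup_{|a|\le s} D(P^\star\|T_aP^\star)=\mathrm{KL}^\star$. Moreover, every $P^\star\in\mathscr{P}_{\mathrm{add}}$ attaining this value is absolutely continuous with respect to Lebesgue measure. -/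

import Mathlib

open MeasureTheory ProbabilityTheory InformationTheory
open scoped ENNReal

namespace OptimalMechanism

/-- The standing assumptions on the cost function: positivity, symmetry, monotonicity in `|x|`,
continuity, and tail regularity `c(x) ∼ β x ^ α` as `x → ∞` for some `α, β > 0`. -/
structure IsCostFunction (c : ℝ → ℝ) : Prop where
  nonneg : ∀ x, 0 ≤ c x
  map_zero : c 0 = 0
  symmetric : ∀ x, c x = c (-x)
  monotone_abs : ∀ x x', |x| ≤ |x'| → c x ≤ c x'
  continuous : Continuous c
  tail : ∃ α β : ℝ, 0 < α ∧ 0 < β ∧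
    Asymptotics.IsEquivalent Filter.atTop c (fun x : ℝ => β * x ^ α)

/-- The shifted measure `T_a P`, i.e. `(T_a P)(B) = P(B - a)`: the law of `Z + a` for `Z ∼ P`. -/
noncomputable def shift (a : ℝ) (P : Measure ℝ) : Measure ℝ :=
  P.map (fun z => z + a)

/-- The Markov kernels `P_{Y|X}` on `ℝ` with `sup_x E[c(Y - x) | X = x] ≤ C`. The expectation of
the nonnegative function is a Lebesgue integral with values in `[0, ∞]`. -/
def feasibleKernels (c : ℝ → ℝ) (C : ℝ) : Set (Kernel ℝ ℝ) :=
  {κ | IsMarkovKernel κ ∧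
    ⨆ x : ℝ, ∫⁻ y, ENNReal.ofReal (c (y - x)) ∂(κ x) ≤ ENNReal.ofReal C}

/-- `sup_{|x - x'| ≤ s} D(P_{Y|X=x} ‖ P_{Y|X=x'})`, in `[0, ∞]`. -/
noncomputable def kernelObjective (s : ℝ) (κ : Kernel ℝ ℝ) : ℝ≥0∞ :=
  ⨆ (x : ℝ) (x' : ℝ) (_ : |x - x'| ≤ s), klDiv (κ x) (κ x')

/-- `KL⋆`: the optimal value over all feasible Markov kernels. -/
noncomputable def KLStar (s : ℝ) (c : ℝ → ℝ) (C : ℝ) : ℝ≥0∞ :=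
  ⨅ κ ∈ feasibleKernels c C, kernelObjective s κ

/-- The Borel probability measures `P` on `ℝ` (laws of the noise `Z` in `Y = X + Z`) with
`E_P[c] ≤ C`. -/
def feasibleNoise (c : ℝ → ℝ) (C : ℝ) : Set (Measure ℝ) :=
  {P | IsProbabilityMeasure P ∧ ∫⁻ z, ENNReal.ofReal (c z) ∂P ≤ ENNReal.ofReal C}

/-- `sup_{|a| ≤ s} D(P ‖ T_a P)`, in `[0, ∞]`. -/
noncomputable def noiseObjective (s : ℝ) (P : Measure ℝ) : ℝ≥0∞ :=
  ⨆ (a : ℝ) (_ : |a| ≤ s), klDiv P (shift a P)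

/-- `KL⋆_add`: the optimal value over all feasible additive mechanisms. -/
noncomputable def KLStarAdd (s : ℝ) (c : ℝ → ℝ) (C : ℝ) : ℝ≥0∞ :=
  ⨅ P ∈ feasibleNoise c C, noiseObjective s P

end OptimalMechanism

/-! Averaging over translations makes a kernel additive. If `X` is uniform on a window of length
`r`, the law of `Y - X` still meets the cost bound, and joint convexity of the divergence preserves
the privacy bound up to a boundary error of order `|a| / r`. Convexity is used through the dual form
`D(P‖Q) = sup_f ∫ f dP - ∫ (exp f - 1) dQ` over bounded `f`, in which both integrals can be averaged
(`averagedNoise_variational_bound`). For near-optimal kernels and `r → ∞`, these laws are tight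
because the cost grows at infinity. A weak limit is feasible, and the dual bound with continuous `f`
passes to it (`exists_feasibleNoise_of_kernels`). Its objective is therefore at most `KLStar`; since
additive mechanisms are kernels, this gives equality and attainment together. The optimum is finite,
as rescaled power laws show (`KLStarAdd_ne_top`). Hence an optimal `P` satisfies `P ≪ shift a P` for
all `|a| ≤ s`, and Fubini yields `P ≪ volume`. -/

namespace OptimalMechanism

/-! ### Variational formula for the divergence -/

/-- Fenchel–Young inequality for `klFun`, whose convex conjugate is `y ↦ exp y - 1`. -/
lemma mul_sub_exp_sub_one_le_klFun {x : ℝ} (hx : 0 ≤ x) (y : ℝ) :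
    x * y - (Real.exp y - 1) ≤ klFun x := by
  rw [klFun_apply]
  rcases hx.eq_or_lt with rfl | hx
  · have := Real.exp_pos y
    simp only [zero_mul]
    linarith
  · have h1 := Real.add_one_le_exp (-(Real.log x - y))
    have h2 : Real.exp y = x * Real.exp (-(Real.log x - y)) := by
      rw [neg_sub, Real.exp_sub, Real.exp_log hx]
      field_simp
    have h3 := mul_le_mul_of_nonneg_left h1 hx.le
    rw [h2]
    nlinarith

lemma integrable_of_abs_le {α : Type*} [MeasurableSpace α] {P : Measure α} [IsFiniteMeasure P]
    {f : α → ℝ} (hf : Measurable f) {M : ℝ} (hM : ∀ x, |f x| ≤ M) : Integrable f P :=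
  .of_bound hf.aestronglyMeasurable M (ae_of_all _ hM)

lemma abs_exp_sub_one_le {y M : ℝ} (hy : |y| ≤ M) : |Real.exp y - 1| ≤ Real.exp M + 1 := by
  have h1 := Real.exp_pos y
  have h2 : Real.exp y ≤ Real.exp M := Real.exp_le_exp.2 ((le_abs_self y).trans hy)
  rw [abs_le]
  constructor <;> linarith

/-- The easy half of the variational formula for the Kullback–Leibler divergence. -/
lemma integral_sub_integral_exp_le_klDiv {α : Type*} [MeasurableSpace α] {P Q : Measure α}
    [IsProbabilityMeasure P] [IsProbabilityMeasure Q] (h : klDiv P Q ≠ ∞)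
    {f : α → ℝ} (hf : Measurable f) {M : ℝ} (hM : ∀ x, |f x| ≤ M) :
    ∫ x, f x ∂P - ∫ x, (Real.exp (f x) - 1) ∂Q ≤ (klDiv P Q).toReal := by
  obtain ⟨hac, hint⟩ := klDiv_ne_top_iff.1 h
  rw [toReal_klDiv_eq_integral_klFun hac, ← integral_rnDeriv_smul hac, ← integral_sub]
  · refine integral_mono_ae ?_ ((integrable_klFun_rnDeriv_iff hac).2 hint) (ae_of_all _ fun x ↦ ?_)
    · refine .sub ((integrable_rnDeriv_smul_iff hac).2 (integrable_of_abs_le hf hM)) ?_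
      exact integrable_of_abs_le (hf.exp.sub_const 1) fun x ↦ abs_exp_sub_one_le (hM x)
    · exact mul_sub_exp_sub_one_le_klFun ENNReal.toReal_nonneg _
  · exact (integrable_rnDeriv_smul_iff hac).2 (integrable_of_abs_le hf hM)
  · exact integrable_of_abs_le (hf.exp.sub_const 1) fun x ↦ abs_exp_sub_one_le (hM x)

lemma abs_exp_sub_exp_le {a b M : ℝ} (ha : |a| ≤ M) (hb : |b| ≤ M) :
    |Real.exp a - Real.exp b| ≤ Real.exp M * |a - b| := by
  wlog hab : b ≤ a generalizing a b
  · rw [abs_sub_comm, abs_sub_comm a]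
    exact this hb ha (le_of_not_ge hab)
  rw [abs_of_nonneg (sub_nonneg.2 (Real.exp_le_exp.2 hab)), abs_of_nonneg (sub_nonneg.2 hab)]
  have h1 := Real.add_one_le_exp (b - a)
  have h2 : Real.exp b = Real.exp a * Real.exp (b - a) := by rw [← Real.exp_add]; ring_nf
  have h3 : Real.exp a ≤ Real.exp M := Real.exp_le_exp.2 ((le_abs_self a).trans ha)
  calc Real.exp a - Real.exp b = Real.exp a * (1 - Real.exp (b - a)) := by rw [h2]; ring
    _ ≤ Real.exp a * (a - b) := mul_le_mul_of_nonneg_left (by linarith) (Real.exp_pos a).le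
    _ ≤ Real.exp M * (a - b) := mul_le_mul_of_nonneg_right h3 (by linarith)

/-- A variational bound over bounded continuous functions extends to bounded measurable ones. -/
lemma variational_bound_of_continuous {P Q : Measure ℝ}
    [IsProbabilityMeasure P] [IsProbabilityMeasure Q] {K : ℝ}
    (h : ∀ (f : ℝ → ℝ) (M : ℝ), Continuous f → (∀ x, |f x| ≤ M) →
      ∫ x, f x ∂P - ∫ x, (Real.exp (f x) - 1) ∂Q ≤ K)
    {f : ℝ → ℝ} (hf : Measurable f) {M : ℝ} (hM : ∀ x, |f x| ≤ M) :
    ∫ x, f x ∂P - ∫ x, (Real.exp (f x) - 1) ∂Q ≤ K := by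
  have hM0 : 0 ≤ M := (abs_nonneg _).trans (hM 0)
  refine le_of_forall_pos_le_add fun ε hε ↦ ?_
  have hfi : Integrable f (P + Q) := integrable_of_abs_le hf hM
  -- Approximating in L¹ of `P + Q` controls both integrals at once; the factor `Real.exp M` is the
  -- Lipschitz constant of `exp` on `[-M, M]`, where truncation keeps `g'`.
  obtain ⟨g, hg, -⟩ := hfi.exists_boundedContinuous_integral_sub_le
    (ε := ε / Real.exp M) (by positivity)
  set g' : ℝ → ℝ := fun x ↦ max (-M) (min M (g x)) with hg'
  have hgc : Continuous g' := by fun_prop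
  have hgM : ∀ x, |g' x| ≤ M := fun x ↦ by
    rw [abs_le]
    exact ⟨le_max_left _ _, max_le (by linarith) (min_le_left _ _)⟩
  have hfg : ∀ x, |f x - g' x| ≤ |f x - g x| := fun x ↦ by
    have h1 : f x = max (-M) (min M (f x)) := by
      rw [min_eq_right (abs_le.1 (hM x)).2, max_eq_right (abs_le.1 (hM x)).1]
    calc |f x - g' x| = |max (-M) (min M (f x)) - max (-M) (min M (g x))| := by rw [← h1]
      _ ≤ |min M (f x) - min M (g x)| := by
        simpa using abs_max_sub_max_le_max (-M) (min M (f x)) (-M) (min M (g x))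
      _ ≤ |f x - g x| := by
        simpa using abs_min_sub_min_le_max M (f x) M (g x)
  have hgi : Integrable (fun x ↦ f x - g x) (P + Q) :=
    hfi.sub (g.integrable _)
  have hg'i : Integrable (fun x ↦ f x - g' x) (P + Q) :=
    hfi.sub (integrable_of_abs_le hgc.measurable hgM)
  have hsum : ∫ x, |f x - g' x| ∂P + ∫ x, |f x - g' x| ∂Q ≤ ε / Real.exp M := by
    rw [← integral_add_measure hg'i.abs.left_of_add_measure hg'i.abs.right_of_add_measure]
    exact (integral_mono hg'i.abs hgi.abs hfg).trans hg
  have hP : ∫ x, f x ∂P - ∫ x, g' x ∂P ≤ ∫ x, |f x - g' x| ∂P := by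
    rw [← integral_sub (integrable_of_abs_le hf hM) (integrable_of_abs_le hgc.measurable hgM)]
    exact integral_mono hg'i.left_of_add_measure hg'i.abs.left_of_add_measure
      fun x ↦ le_abs_self _
  have hfe := integrable_of_abs_le (P := Q) (hf.exp.sub_const 1) fun x ↦ abs_exp_sub_one_le (hM x)
  have hge := integrable_of_abs_le (P := Q) (hgc.measurable.exp.sub_const 1)
    fun x ↦ abs_exp_sub_one_le (hgM x)
  have hQ : ∫ x, (Real.exp (g' x) - 1) ∂Q - ∫ x, (Real.exp (f x) - 1) ∂Q
      ≤ Real.exp M * ∫ x, |f x - g' x| ∂Q := by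
    rw [← integral_sub hge hfe, ← integral_const_mul]
    refine integral_mono (hge.sub hfe) (hg'i.abs.right_of_add_measure.const_mul _) fun x ↦ ?_
    have := abs_exp_sub_exp_le (hgM x) (hM x)
    rw [abs_sub_comm (g' x)] at this
    simp only
    linarith [le_abs_self (Real.exp (g' x) - Real.exp (f x))]
  have hPn : 0 ≤ ∫ x, |f x - g' x| ∂P := integral_nonneg fun x ↦ abs_nonneg _
  have h1M : 1 ≤ Real.exp M := Real.one_le_exp hM0
  have hsum' : Real.exp M * (∫ x, |f x - g' x| ∂P + ∫ x, |f x - g' x| ∂Q) ≤ ε := by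
    rwa [le_div_iff₀' (Real.exp_pos M)] at hsum
  have := h g' M hgc hgM
  nlinarith

/-- `x log y - y + 1` is nonnegative when `y` is `x` clamped to `[b⁻¹, b]`. -/
lemma sub_one_le_mul_log_clamp {x b : ℝ} (hb : 1 ≤ b) :
    max b⁻¹ (min b x) - 1 ≤ x * Real.log (max b⁻¹ (min b x)) := by
  set y := max b⁻¹ (min b x) with hy
  have hb0 : 0 < b := by linarith
  have hbi : 0 < b⁻¹ := inv_pos.2 hb0
  have hb1 : b⁻¹ ≤ 1 := inv_le_one_of_one_le₀ hb
  have hy0 : 0 < y := hbi.trans_le (le_max_left _ _)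
  have key : y - 1 ≤ y * Real.log y := by
    have := mul_le_mul_of_nonneg_left (Real.one_sub_inv_le_log_of_pos hy0) hy0.le
    rw [mul_sub, mul_inv_cancel₀ hy0.ne'] at this
    linarith
  -- Clamping moves `x` towards `1`, so `x - y` and `log y` never have opposite signs.
  refine key.trans ?_
  rcases le_total 1 y with h1 | h1
  · rcases h1.eq_or_lt with h1 | h1
    · simp [← h1]
    have : y ≤ x := by
      rcases le_total b⁻¹ (min b x) with h | h
      · rw [hy, max_eq_right h]; exact min_le_right _ _
      · rw [hy, max_eq_left h] at h1; linarith
    exact mul_le_mul_of_nonneg_right this (Real.log_nonneg h1.le)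
  · have : x ≤ y ∨ y = 1 := by
      rcases le_total b x with h | h
      · right
        apply le_antisymm h1
        rw [hy, min_eq_left h]; exact hb.trans (le_max_right _ _)
      · left
        rw [hy, min_eq_right h]; exact le_max_right _ _
    rcases this with h | h
    · exact mul_le_mul_of_nonpos_right h (Real.log_nonpos hy0.le h1)
    · simp [h]

/-- For `x > 0` the sequence is eventually constant. At `x = 0` the product vanishes and the rest
tends to `1 = klFun 0`. -/
lemma tendsto_clamp_klFun {x : ℝ} (hx : 0 ≤ x) :
    Filter.Tendsto (fun n : ℕ ↦ x * Real.log (max ((n : ℝ) + 1)⁻¹ (min ((n : ℝ) + 1) x))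
      - (max ((n : ℝ) + 1)⁻¹ (min ((n : ℝ) + 1) x) - 1)) Filter.atTop (nhds (klFun x)) := by
  have h1 : Filter.Tendsto (fun n : ℕ ↦ (n : ℝ) + 1) Filter.atTop Filter.atTop :=
    Filter.tendsto_atTop_add_const_right _ _ tendsto_natCast_atTop_atTop
  have h2 : Filter.Tendsto (fun n : ℕ ↦ ((n : ℝ) + 1)⁻¹) Filter.atTop (nhds 0) :=
    tendsto_inv_atTop_zero.comp h1
  rcases hx.eq_or_lt with rfl | hx
  · have h3 : ∀ n : ℕ, max ((n : ℝ) + 1)⁻¹ (min ((n : ℝ) + 1) 0) = ((n : ℝ) + 1)⁻¹ := fun n ↦ by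
      rw [min_eq_right (by positivity), max_eq_left (by positivity)]
    simp only [h3, zero_mul, klFun_zero]
    simpa using (h2.sub_const 1).const_sub 0
  · refine tendsto_const_nhds.congr' ?_
    filter_upwards [h1.eventually_ge_atTop x, h2.eventually_le_const hx] with n hn hn'
    rw [min_eq_right hn, max_eq_right hn', klFun_apply]
    ring

/-- The converse half of the variational formula for the Kullback–Leibler divergence. -/
lemma klDiv_le_of_variational_bound {α : Type*} [MeasurableSpace α] {P Q : Measure α}
    [IsProbabilityMeasure P] [IsProbabilityMeasure Q] {K : ℝ}
    (h : ∀ (f : α → ℝ) (M : ℝ), Measurable f → (∀ x, |f x| ≤ M) →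
      ∫ x, f x ∂P - ∫ x, (Real.exp (f x) - 1) ∂Q ≤ K) :
    klDiv P Q ≤ ENNReal.ofReal K := by
  have hac : P ≪ Q := by
    refine Measure.AbsolutelyContinuous.mk fun B hB hQB ↦ ?_
    by_contra hPB
    have hpos : 0 < P.real B := ENNReal.toReal_pos hPB (measure_ne_top _ _)
    -- Testing with `N` times the indicator of a `Q`-null set `B` gives `N * P.real B ≤ K`.
    obtain ⟨N, hN⟩ := exists_nat_gt (K / P.real B)
    rw [div_lt_iff₀ hpos] at hN
    have := h (B.indicator fun _ ↦ (N : ℝ)) N (measurable_const.indicator hB) fun x ↦ by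
      by_cases hx : x ∈ B <;> simp [hx]
    have hQ : ∫ x, (Real.exp (B.indicator (fun _ ↦ (N : ℝ)) x) - 1) ∂Q = 0 := by
      refine integral_eq_zero_of_ae ?_
      filter_upwards [measure_eq_zero_iff_ae_notMem.1 hQB] with x hx
      simp [hx]
    rw [hQ, integral_indicator_const _ hB, smul_eq_mul] at this
    linarith
  rw [klDiv_eq_lintegral_klFun_of_ac hac]
  set g : α → ℝ := fun x ↦ (P.rnDeriv Q x).toReal with hg
  have hgm : Measurable g := (Measure.measurable_rnDeriv P Q).ennreal_toReal
  -- The optimal test function is the log-density; clamping the density makes it bounded, and Fatou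
  -- removes the clamp because the integrands are nonnegative.
  set φ : ℕ → α → ℝ := fun n x ↦ max ((n : ℝ) + 1)⁻¹ (min ((n : ℝ) + 1) (g x)) with hφ
  have hφm : ∀ n, Measurable (φ n) := fun n ↦
    measurable_const.max (measurable_const.min hgm)
  have hφ0 : ∀ n x, 0 < φ n x := fun n x ↦ lt_max_of_lt_left (by positivity)
  have hφlog : ∀ n x, |Real.log (φ n x)| ≤ Real.log ((n : ℝ) + 1) := fun n x ↦ by
    rw [abs_le, ← Real.log_inv]
    refine ⟨Real.log_le_log (by positivity) (le_max_left _ _), Real.log_le_log (hφ0 n x) ?_⟩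
    refine max_le ?_ (min_le_left _ _)
    have : (1 : ℝ) ≤ (n : ℝ) + 1 := by simp
    exact (inv_le_one_of_one_le₀ this).trans this
  have hbound : ∀ n, ∫⁻ x, ENNReal.ofReal (g x * Real.log (φ n x) - (φ n x - 1)) ∂Q
      ≤ ENNReal.ofReal K := fun n ↦ by
    have hi1 : Integrable (fun x ↦ g x * Real.log (φ n x)) Q :=
      (integrable_rnDeriv_smul_iff hac).2 (integrable_of_abs_le (hφm n).log (hφlog n))
    have hi2 : Integrable (fun x ↦ φ n x - 1) Q := by
      have := integrable_of_abs_le (P := Q) ((hφm n).log.exp.sub_const 1)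
        fun x ↦ abs_exp_sub_one_le (hφlog n x)
      simpa only [Real.exp_log (hφ0 n _)] using this
    have hi : Integrable (fun x ↦ g x * Real.log (φ n x) - (φ n x - 1)) Q := hi1.sub hi2
    rw [← ofReal_integral_eq_lintegral_ofReal hi (ae_of_all _ fun x ↦ ?_)]
    · refine ENNReal.ofReal_le_ofReal ?_
      have := h (fun x ↦ Real.log (φ n x)) _ (hφm n).log (hφlog n)
      rw [← integral_rnDeriv_smul hac] at this
      simp only [Real.exp_log (hφ0 n _)] at this
      rw [integral_sub hi1 hi2]
      exact this
    · exact sub_nonneg.2 (sub_one_le_mul_log_clamp (by simp))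
  have hlim : ∀ x, Filter.Tendsto
      (fun n ↦ ENNReal.ofReal (g x * Real.log (φ n x) - (φ n x - 1))) Filter.atTop
      (nhds (ENNReal.ofReal (klFun (g x)))) := fun x ↦
    (ENNReal.continuous_ofReal.tendsto _).comp (tendsto_clamp_klFun ENNReal.toReal_nonneg)
  calc ∫⁻ x, ENNReal.ofReal (klFun (g x)) ∂Q
      = ∫⁻ x, Filter.liminf
          (fun n ↦ ENNReal.ofReal (g x * Real.log (φ n x) - (φ n x - 1))) Filter.atTop ∂Q :=
        lintegral_congr fun x ↦ (hlim x).liminf_eq.symm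
    _ ≤ Filter.liminf (fun n ↦ ∫⁻ x,
          ENNReal.ofReal (g x * Real.log (φ n x) - (φ n x - 1)) ∂Q) Filter.atTop :=
        lintegral_liminf_le fun n ↦
          ((hgm.mul (hφm n).log).sub ((hφm n).sub_const 1)).ennreal_ofReal
    _ ≤ ENNReal.ofReal K :=
        Filter.liminf_le_of_frequently_le' (Filter.Frequently.of_forall hbound)

/-- If `P ≤ M • Q` then `klDiv P Q` is bounded in terms of `M` only. -/
lemma exists_klDiv_le_of_le_smul {α : Type*} [MeasurableSpace α] {M : ℝ≥0∞} (hM : M ≠ ∞) :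
    ∃ A : ℝ, ∀ (P Q : Measure α) [IsProbabilityMeasure P] [IsProbabilityMeasure Q],
      P ≤ M • Q → klDiv P Q ≤ ENNReal.ofReal A := by
  obtain ⟨A, hA⟩ := (isCompact_Icc (a := (0 : ℝ)) (b := M.toReal)).bddAbove_image
    continuous_klFun.continuousOn
  refine ⟨A, fun P Q _ _ h ↦ ?_⟩
  have hac : P ≪ Q := (Measure.absolutelyContinuous_of_le h).trans
    (Measure.smul_absolutelyContinuous)
  have hle : ∀ᵐ x ∂Q, P.rnDeriv Q x ≤ M := by
    refine ae_le_of_forall_setLIntegral_le_of_sigmaFinite (Measure.measurable_rnDeriv P Q)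
      fun B hB _ ↦ ?_
    rw [setLIntegral_const]
    exact (Measure.setLIntegral_rnDeriv_le B).trans (h B)
  rw [klDiv_eq_lintegral_klFun_of_ac hac]
  calc _ ≤ ∫⁻ _, ENNReal.ofReal A ∂Q := by
        refine lintegral_mono_ae ?_
        filter_upwards [hle] with x hx
        exact ENNReal.ofReal_le_ofReal (hA ⟨_, ⟨ENNReal.toReal_nonneg,
          ENNReal.toReal_mono hM hx⟩, rfl⟩)
    _ = _ := by simp

/-! ### Averaging a kernel over translations -/

/-- The average over `x ∈ (0, r]` of the laws of `Y - x` given `X = x`. -/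
noncomputable def averagedNoise (κ : Kernel ℝ ℝ) (r : ℝ) : Measure ℝ :=
  (cond volume (Set.Ioc 0 r) ⊗ₘ κ).map fun p ↦ p.2 - p.1

lemma measurable_snd_sub_fst : Measurable fun p : ℝ × ℝ ↦ p.2 - p.1 :=
  measurable_snd.sub measurable_fst

lemma isProbabilityMeasure_cond_Ioc {r : ℝ} (hr : 0 < r) :
    IsProbabilityMeasure (cond (volume : Measure ℝ) (Set.Ioc 0 r)) :=
  cond_isProbabilityMeasure_of_finite (by simpa using hr) (by simp)

lemma isProbabilityMeasure_averagedNoise (κ : Kernel ℝ ℝ) [IsMarkovKernel κ] {r : ℝ}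
    (hr : 0 < r) : IsProbabilityMeasure (averagedNoise κ r) := by
  have := isProbabilityMeasure_cond_Ioc hr
  exact Measure.isProbabilityMeasure_map measurable_snd_sub_fst.aemeasurable

lemma lintegral_averagedNoise_le (κ : Kernel ℝ ℝ) [IsMarkovKernel κ] {r : ℝ} (hr : 0 < r)
    {f : ℝ → ℝ≥0∞} (hf : Measurable f) {A : ℝ≥0∞} (hA : ∀ x, ∫⁻ y, f (y - x) ∂(κ x) ≤ A) :
    ∫⁻ z, f z ∂(averagedNoise κ r) ≤ A := by
  have := isProbabilityMeasure_cond_Ioc hr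
  rw [averagedNoise, lintegral_map hf measurable_snd_sub_fst,
    Measure.lintegral_compProd (f := fun p : ℝ × ℝ ↦ f (p.2 - p.1))
      (hf.comp measurable_snd_sub_fst)]
  calc _ ≤ ∫⁻ _, A ∂(cond (volume : Measure ℝ) (Set.Ioc 0 r)) := lintegral_mono hA
    _ = A := by simp

lemma integral_averagedNoise (κ : Kernel ℝ ℝ) [IsMarkovKernel κ] {r : ℝ} (hr : 0 < r)
    {f : ℝ → ℝ} (hf : Measurable f) {M : ℝ} (hM : ∀ x, |f x| ≤ M) :
    ∫ z, f z ∂(averagedNoise κ r) = r⁻¹ * ∫ x in 0..r, ∫ y, f (y - x) ∂(κ x) := by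
  have := isProbabilityMeasure_cond_Ioc hr
  rw [averagedNoise, integral_map measurable_snd_sub_fst.aemeasurable hf.aestronglyMeasurable,
    Measure.integral_compProd (f := fun p : ℝ × ℝ ↦ f (p.2 - p.1))
      (integrable_of_abs_le (hf.comp measurable_snd_sub_fst) fun x ↦ hM _),
    ProbabilityTheory.cond, integral_smul_measure, intervalIntegral.integral_of_le hr.le]
  simp [hr.le]

lemma abs_integral_le_of_abs_le {α : Type*} [MeasurableSpace α] {P : Measure α}
    [IsProbabilityMeasure P] {f : α → ℝ} {M : ℝ} (hM : ∀ x, |f x| ≤ M) : |∫ x, f x ∂P| ≤ M := by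
  simpa using norm_integral_le_of_norm_le_const (μ := P) (f := f) (ae_of_all _ hM)

lemma measurable_integral_sub_kernel (κ : Kernel ℝ ℝ) [IsMarkovKernel κ] {f : ℝ → ℝ}
    (hf : Measurable f) : Measurable fun x ↦ ∫ y, f (y - x) ∂(κ x) := by
  have : StronglyMeasurable (Function.uncurry fun x y : ℝ ↦ f (y - x)) :=
    (hf.comp measurable_snd_sub_fst).stronglyMeasurable
  exact (this.integral_kernel_prod_right (κ := κ)).measurable

lemma intervalIntegrable_of_abs_le {f : ℝ → ℝ} (hf : Measurable f) {M : ℝ}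
    (hM : ∀ x, |f x| ≤ M) (a b : ℝ) : IntervalIntegrable f volume a b :=
  ⟨integrable_of_abs_le hf hM, integrable_of_abs_le hf hM⟩

/-- The two windows differ by end pieces of length `|a|`, each contributing at most `M * |a|`. -/
lemma intervalIntegral_le_comp_sub_add {f : ℝ → ℝ} (hf : Measurable f) {M : ℝ}
    (hM : ∀ x, |f x| ≤ M) (a r : ℝ) :
    ∫ x in 0..r, f x ≤ (∫ x in 0..r, f (x - a)) + 2 * M * |a| := by
  have hi := intervalIntegrable_of_abs_le hf hM
  have h1 := intervalIntegral.norm_integral_le_of_norm_le_const (a := 0) (b := 0 - a) (f := f)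
    (C := M) fun x _ ↦ hM x
  have h2 := intervalIntegral.norm_integral_le_of_norm_le_const (a := r) (b := r - a) (f := f)
    (C := M) fun x _ ↦ hM x
  have h3 := intervalIntegral.integral_interval_sub_interval_comm (hi 0 r) (hi (0 - a) (r - a))
    (hi 0 (0 - a))
  rw [intervalIntegral.integral_comp_sub_right]
  simp only [Real.norm_eq_abs, zero_sub, sub_sub_cancel_left, sub_zero, abs_neg] at h1 h2 h3 ⊢
  have := abs_le.1 h1
  have := abs_le.1 h2
  linarith

/-- Averaging a kernel preserves the variational bound up to a boundary term of order `|a| / r`. -/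
lemma averagedNoise_variational_bound (κ : Kernel ℝ ℝ) [IsMarkovKernel κ] {r : ℝ} (hr : 0 < r)
    {a K : ℝ} (hK : 0 ≤ K) (h : ∀ x, klDiv (κ x) (κ (x + a)) ≤ ENNReal.ofReal K)
    {f : ℝ → ℝ} (hf : Measurable f) {M : ℝ} (hM : ∀ x, |f x| ≤ M) :
    ∫ z, f z ∂(averagedNoise κ r) - ∫ z, (Real.exp (f (z + a)) - 1) ∂(averagedNoise κ r)
      ≤ K + 2 * (Real.exp M + 1) * |a| * r⁻¹ := by
  set F : ℝ → ℝ := fun x ↦ ∫ y, f (y - x) ∂(κ x) with hF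
  set H : ℝ → ℝ := fun x ↦ ∫ y, (Real.exp (f (y - x)) - 1) ∂(κ (x + a)) with hH
  have hem : Measurable fun z ↦ Real.exp (f z) - 1 := hf.exp.sub_const 1
  have heM : ∀ z, |Real.exp (f z) - 1| ≤ Real.exp M + 1 := fun z ↦ abs_exp_sub_one_le (hM z)
  have hem' : Measurable fun z ↦ Real.exp (f (z + a)) - 1 := hem.comp (measurable_add_const a)
  have hFm : Measurable F := measurable_integral_sub_kernel κ hf
  have hHm : Measurable H := by
    have := (measurable_integral_sub_kernel κ hem').comp (measurable_add_const a)
    have heq : H = (fun x ↦ ∫ y, (Real.exp (f (y - x + a)) - 1) ∂(κ x)) ∘ fun x ↦ x + a := by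
      funext x
      simp only [hH, Function.comp_apply, sub_add_eq_sub_sub, sub_add_cancel]
    rwa [heq]
  have hFM : ∀ x, |F x| ≤ M := fun x ↦ abs_integral_le_of_abs_le fun y ↦ hM _
  have hHM : ∀ x, |H x| ≤ Real.exp M + 1 := fun x ↦ abs_integral_le_of_abs_le fun y ↦ heM _
  have hFH : ∀ x, F x ≤ K + H x := fun x ↦ by
    have hne : klDiv (κ x) (κ (x + a)) ≠ ∞ := ne_top_of_le_ne_top ENNReal.ofReal_ne_top (h x)
    have h1 := integral_sub_integral_exp_le_klDiv hne (hf.comp (measurable_sub_const x))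
      fun y ↦ hM _
    have h2 := ENNReal.toReal_le_of_le_ofReal hK (h x)
    simp only [Function.comp_apply] at h1
    simp only [hF, hH]
    linarith
  -- After the shift by `a`, the measure at `x` is paired with `y - (x - a)`, which is `H` at `x -
  -- a`.
  have hshift : ∫ x in 0..r, ∫ y, (Real.exp (f (y - x + a)) - 1) ∂(κ x)
      = ∫ x in 0..r, H (x - a) := by
    refine intervalIntegral.integral_congr fun x _ ↦ ?_
    simp only [hH, sub_add_cancel, sub_sub_eq_add_sub, sub_add_eq_add_sub]
  rw [integral_averagedNoise κ hr hf hM, integral_averagedNoise κ hr hem' fun z ↦ heM _, hshift,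
    ← mul_sub]
  have h1 : ∫ x in 0..r, F x ≤ ∫ x in 0..r, (K + H x) :=
    intervalIntegral.integral_mono hr.le (intervalIntegrable_of_abs_le hFm hFM _ _)
      (intervalIntegrable_const.add (intervalIntegrable_of_abs_le hHm hHM _ _)) hFH
  rw [intervalIntegral.integral_add intervalIntegrable_const
    (intervalIntegrable_of_abs_le hHm hHM _ _)] at h1
  have h2 := intervalIntegral_le_comp_sub_add hHm hHM a r
  simp only [intervalIntegral.integral_const, sub_zero, smul_eq_mul] at h1
  calc r⁻¹ * ((∫ x in 0..r, F x) - ∫ x in 0..r, H (x - a))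
      ≤ r⁻¹ * (r * K + 2 * (Real.exp M + 1) * |a|) := by
        gcongr
        linarith
    _ = _ := by field_simp

/-! ### Tightness and passage to the limit -/

lemma IsCostFunction.tendsto_atTop {c : ℝ → ℝ} (hc : IsCostFunction c) :
    Filter.Tendsto c Filter.atTop Filter.atTop := by
  obtain ⟨α, β, hα, hβ, h⟩ := hc.tail
  exact h.symm.tendsto_atTop ((tendsto_rpow_atTop hα).const_mul_atTop hβ)

lemma IsCostFunction.isTightMeasureSet {c : ℝ → ℝ} (hc : IsCostFunction c) {C : ℝ} :
    IsTightMeasureSet (feasibleNoise c C) := by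
  rw [isTightMeasureSet_iff_exists_isCompact_measure_compl_le]
  intro ε hε
  obtain ⟨δ, hδ, hδε⟩ : ∃ δ : ℝ, 0 < δ ∧ ENNReal.ofReal δ ≤ ε := by
    rcases eq_or_ne ε ∞ with rfl | hε'
    · exact ⟨1, one_pos, le_top⟩
    · exact ⟨ε.toReal, ENNReal.toReal_pos hε.ne' hε', ENNReal.ofReal_toReal_le⟩
  -- Markov's inequality bounds the mass outside `[-R, R]` by `C / c R ≤ δ`; the `1` in the maximum
  -- ensures `c R > 0`.
  obtain ⟨R, hR1, hR⟩ := ((hc.tendsto_atTop.eventually_ge_atTop (max 1 (C / δ))).and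
    (Filter.eventually_ge_atTop 0)).exists
  refine ⟨Set.Icc (-R) R, isCompact_Icc, fun P hP ↦ ?_⟩
  have hcR : 0 < c R := one_pos.trans_le ((le_max_left _ _).trans hR1)
  have hsub : (Set.Icc (-R) R)ᶜ ⊆ {z | ENNReal.ofReal (c R) ≤ ENNReal.ofReal (c z)} := by
    intro z hz
    refine ENNReal.ofReal_le_ofReal (hc.monotone_abs _ _ ?_)
    rw [abs_of_nonneg hR]
    by_contra! h
    exact hz ⟨(abs_lt.1 h).1.le, (abs_lt.1 h).2.le⟩
  have hmarkov := mul_meas_ge_le_lintegral (μ := P)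
    hc.continuous.measurable.ennreal_ofReal (ENNReal.ofReal (c R))
  refine (measure_mono hsub).trans (le_trans ?_ hδε)
  have h1 := hmarkov.trans hP.2
  rw [mul_comm, ← ENNReal.le_div_iff_mul_le (by simp [hcR]) (by simp),
    ← ENNReal.ofReal_div_of_pos hcR] at h1
  refine h1.trans (ENNReal.ofReal_le_ofReal ?_)
  rw [div_le_iff₀ hcR]
  have := (le_max_right _ _).trans hR1
  rwa [div_le_iff₀' hδ] at this

/-- Compactness and lower semicontinuity: feasible kernels whose objectives approach `K` yield
a feasible additive noise with objective at most `K`. -/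
lemma exists_feasibleNoise_of_kernels {c : ℝ → ℝ} (hc : IsCostFunction c) {s C K : ℝ}
    {κ : ℕ → Kernel ℝ ℝ} (hκ : ∀ n, κ n ∈ feasibleKernels c C) {k : ℕ → ℝ} (hk0 : ∀ n, 0 ≤ k n)
    (hk : Filter.Tendsto k Filter.atTop (nhds K))
    (hobj : ∀ n, kernelObjective s (κ n) ≤ ENNReal.ofReal (k n)) :
    ∃ P ∈ feasibleNoise c C, noiseObjective s P ≤ ENNReal.ofReal K := by
  have hmk : ∀ n, IsMarkovKernel (κ n) := fun n ↦ (hκ n).1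
  have hr : ∀ n : ℕ, (0 : ℝ) < (n : ℝ) + 1 := fun n ↦ by positivity
  -- Windows of length `n + 1` make the boundary error vanish in the limit.
  set p : ℕ → ProbabilityMeasure ℝ := fun n ↦
    ⟨averagedNoise (κ n) ((n : ℝ) + 1), isProbabilityMeasure_averagedNoise (κ n) (hr n)⟩ with hp
  have hfeas : ∀ n, (p n : Measure ℝ) ∈ feasibleNoise c C := fun n ↦
    ⟨isProbabilityMeasure_averagedNoise (κ n) (hr n),
      lintegral_averagedNoise_le (κ n) (hr n) hc.continuous.measurable.ennreal_ofReal
        (iSup_le_iff.1 (hκ n).2)⟩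
  have htight : IsTightMeasureSet {(μ : Measure ℝ) | μ ∈ Set.range p} := by
    refine hc.isTightMeasureSet.subset (T := feasibleNoise c C) ?_
    rintro _ ⟨_, ⟨n, rfl⟩, rfl⟩
    exact hfeas n
  obtain ⟨q, -, φ, hφ, hq⟩ := (isCompact_closure_of_isTightMeasureSet htight).tendsto_subseq
    fun n ↦ subset_closure (Set.mem_range_self n)
  refine ⟨q, ⟨q.2, ?_⟩, iSup₂_le fun a ha ↦ ?_⟩
  -- The cost is unbounded, so only lower semicontinuity is available; it suffices for feasibility.
  · refine (lintegral_le_liminf_lintegral_of_forall_isOpen_measure_le_liminf_measure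
      (μs := fun n ↦ (p (φ n) : Measure ℝ)) hc.continuous hc.nonneg fun G hG ↦
        ProbabilityMeasure.le_liminf_measure_open_of_tendsto hq hG).trans ?_
    exact Filter.liminf_le_of_frequently_le' (Filter.Frequently.of_forall fun n ↦ (hfeas _).2)
  · have hshift : IsProbabilityMeasure (shift a (q : Measure ℝ)) :=
      Measure.isProbabilityMeasure_map (measurable_add_const a).aemeasurable
    refine klDiv_le_of_variational_bound fun f M hf hM ↦
      variational_bound_of_continuous (fun f M hf hM ↦ ?_) hf hM
    have hexp : Continuous fun z ↦ Real.exp (f z) - 1 := by fun_prop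
    have hlim : ∀ (g : ℝ → ℝ) (B : ℝ), Continuous g → (∀ x, |g x| ≤ B) →
        Filter.Tendsto (fun n ↦ ∫ z, g z ∂(p (φ n) : Measure ℝ)) Filter.atTop
          (nhds (∫ z, g z ∂(q : Measure ℝ))) := fun g B hg hB ↦
      ProbabilityMeasure.tendsto_iff_forall_integral_tendsto.1 hq
        (BoundedContinuousFunction.ofNormedAddCommGroup g hg B hB)
    rw [shift, integral_map (measurable_add_const a).aemeasurable
      hexp.aestronglyMeasurable]
    have h1 := hlim f M hf hM
    have h2 := hlim (fun z ↦ Real.exp (f (z + a)) - 1) _ (by fun_prop)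
      fun z ↦ abs_exp_sub_one_le (hM _)
    have h3 : Filter.Tendsto (fun n : ℕ ↦ k n + 2 * (Real.exp M + 1) * |a| * ((n : ℝ) + 1)⁻¹)
        Filter.atTop (nhds (K + 2 * (Real.exp M + 1) * |a| * 0)) := by
      refine hk.add (Filter.Tendsto.const_mul _ (tendsto_inv_atTop_zero.comp ?_))
      exact Filter.tendsto_atTop_add_const_right _ _ tendsto_natCast_atTop_atTop
    rw [mul_zero, add_zero] at h3
    refine le_of_tendsto_of_tendsto' (h1.sub h2) (h3.comp hφ.tendsto_atTop) fun n ↦ ?_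
    refine averagedNoise_variational_bound (κ (φ n)) (hr (φ n)) (hk0 _) (fun x ↦ ?_)
      hf.measurable hM
    refine le_trans ?_ (hobj (φ n))
    refine le_iSup_of_le x (le_iSup_of_le (x + a) (le_iSup_of_le ?_ le_rfl))
    simpa using ha

/-! ### Additive mechanisms as kernels -/

lemma KLStar_le_KLStarAdd {c : ℝ → ℝ} (hc : IsCostFunction c) (s C : ℝ) :
    KLStar s c C ≤ KLStarAdd s c C := by
  refine le_iInf₂ fun P hP ↦ ?_
  have hPp : IsProbabilityMeasure P := hP.1
  have hadd : Measurable fun p : ℝ × ℝ ↦ p.2 + p.1 := measurable_snd.add measurable_fst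
  set κ : Kernel ℝ ℝ := (Kernel.id ×ₖ Kernel.const ℝ P).map fun p ↦ p.2 + p.1 with hκ
  have hκx : ∀ x, κ x = shift x P := fun x ↦ by
    rw [hκ, Kernel.map_apply _ hadd, Kernel.prod_apply, Kernel.id_apply, Kernel.const_apply,
      Measure.dirac_prod, Measure.map_map hadd (by fun_prop)]
    rfl
  have hmk : IsMarkovKernel κ := Kernel.IsMarkovKernel.map _ hadd
  refine (iInf₂_le κ ⟨hmk, iSup_le fun x ↦ ?_⟩).trans ?_
  · refine iSup_le fun x ↦ iSup_le fun x' ↦ iSup_le fun h ↦ ?_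
    have h1 : κ x' = (shift (x' - x) P).map fun z ↦ z + x := by
      rw [hκx, shift, shift, Measure.map_map (measurable_add_const _) (measurable_add_const _)]
      congr 1
      funext z
      simp only [Function.comp_apply]
      ring
    have hsh : IsProbabilityMeasure (shift (x' - x) P) :=
      Measure.isProbabilityMeasure_map (measurable_add_const _).aemeasurable
    rw [h1, hκx, shift]
    -- Data processing under translation by `x` reduces the pair `(x, x')` to `(0, x' - x)`.
    refine (klDiv_map_le _ _ (measurable_add_const x)).trans ?_
    exact le_iSup₂_of_le (f := fun a (_ : |a| ≤ s) ↦ klDiv P (shift a P)) (x' - x)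
      (by rwa [abs_sub_comm]) le_rfl
  · rw [hκx, shift, lintegral_map (by
      have := hc.continuous.measurable
      fun_prop) (measurable_add_const x)]
    simpa using hP.2

/-! ### Absolute continuity -/

/-- A measure absolutely continuous with respect to all its small translates is absolutely
continuous with respect to Lebesgue measure. -/
lemma absolutelyContinuous_volume_of_shift {P : Measure ℝ} [IsProbabilityMeasure P] {s : ℝ}
    (hs : 0 < s) (h : ∀ a, |a| ≤ s → P ≪ shift a P) : P ≪ (volume : Measure ℝ) := by
  refine Measure.AbsolutelyContinuous.mk fun B hB hB0 ↦ ?_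
  have hadd : Measurable fun p : ℝ × ℝ ↦ p.2 + p.1 := measurable_snd.add measurable_fst
  have hind : Measurable (B.indicator (1 : ℝ → ℝ≥0∞)) := measurable_one.indicator hB
  have hzero : ∫⁻ a, shift a P B = 0 := by
    have h1 : ∀ a, shift a P B = ∫⁻ z, B.indicator (1 : ℝ → ℝ≥0∞) (z + a) ∂P := fun a ↦ by
      rw [← lintegral_indicator_one hB, shift, lintegral_map hind (measurable_add_const a)]
    simp_rw [h1]
    -- For fixed `z`, the integral over `a` is the Lebesgue measure of a translate of `B`, hence
    -- zero.
    rw [lintegral_lintegral_swap (f := fun a z ↦ B.indicator (1 : ℝ → ℝ≥0∞) (z + a))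
      (hind.comp hadd).aemeasurable]
    simp_rw [lintegral_add_left_eq_self (B.indicator (1 : ℝ → ℝ≥0∞)), lintegral_indicator_one hB,
      hB0, lintegral_zero]
  have hmeas : Measurable fun a ↦ shift a P B := by
    have h1 : ∀ a, shift a P B = P (Prod.mk a ⁻¹' ((fun p : ℝ × ℝ ↦ p.2 + p.1) ⁻¹' B)) :=
      fun a ↦ Measure.map_apply (measurable_add_const a) hB
    simp_rw [h1]
    exact measurable_measure_prodMk_left (hadd hB)
  rw [lintegral_eq_zero_iff hmeas] at hzero
  by_contra hPB
  have hall : ∀ a ∈ Set.Icc (-s) s, shift a P B ≠ 0 := fun a ha h0 ↦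
    hPB (h a (abs_le.2 ha) h0)
  have : volume (Set.Icc (-s) s) = 0 :=
    measure_mono_null hall (ae_iff.1 hzero)
  rw [Real.volume_Icc, ENNReal.ofReal_eq_zero] at this
  linarith

/-! ### Finiteness of the optimal value -/

lemma IsCostFunction.exists_le_rpow {c : ℝ → ℝ} (hc : IsCostFunction c) :
    ∃ A α : ℝ, 0 < A ∧ 0 < α ∧ ∀ x, c x ≤ A * (1 + |x|) ^ α := by
  obtain ⟨α, β, hα, hβ, h⟩ := hc.tail
  have hO : ∀ᶠ x in Filter.atTop, c x ≤ 2 * (β * x ^ α) := by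
    filter_upwards [h.def (c := 1) one_pos, Filter.eventually_ge_atTop 0] with x hx hx0
    have h0 : 0 ≤ β * x ^ α := by positivity
    simp only [Pi.sub_apply, Real.norm_eq_abs, abs_of_nonneg h0] at hx
    linarith [le_abs_self (c x - β * x ^ α)]
  obtain ⟨X, hX0, hX⟩ := (Filter.atTop_basis' (0 : ℝ)).eventually_iff.1 hO
  refine ⟨2 * β * (1 + X) ^ α, α, by positivity, hα, fun x ↦ ?_⟩
  have hx := abs_nonneg x
  -- Monotonicity moves the argument past the threshold `X`, where the tail bound applies.
  calc c x ≤ c (X + |x|) := hc.monotone_abs _ _ (by rw [abs_of_nonneg (add_nonneg hX0 hx)]; linarith)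
    _ ≤ 2 * (β * (X + |x|) ^ α) := hX (Set.mem_Ici.2 (by linarith))
    _ ≤ 2 * (β * ((1 + X) * (1 + |x|)) ^ α) := by
      gcongr
      nlinarith [mul_nonneg hX0 hx]
    _ = _ := by rw [Real.mul_rpow (by positivity) (by positivity)]; ring

/-- The unnormalized power-law density `(1 + |x|) ^ (-r)`. -/
noncomputable def powerLawDensity (r : ℝ) (x : ℝ) : ℝ≥0∞ :=
  ENNReal.ofReal ((1 + |x|) ^ (-r))

lemma measurable_powerLawDensity (r : ℝ) : Measurable (powerLawDensity r) := by
  unfold powerLawDensity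
  fun_prop

/-- This is `1 + |x - a| ≤ (1 + |x|) * (1 + |a|)` raised to the power `r`. Polynomial tails keep the
ratio of translates bounded. -/
lemma powerLawDensity_le {r : ℝ} (hr : 0 ≤ r) (a x : ℝ) :
    powerLawDensity r x ≤ ENNReal.ofReal ((1 + |a|) ^ r) * powerLawDensity r (x - a) := by
  have ha := abs_nonneg a
  have hx := abs_nonneg x
  have hxa := abs_nonneg (x - a)
  rw [powerLawDensity, powerLawDensity, ← ENNReal.ofReal_mul (by positivity)]
  refine ENNReal.ofReal_le_ofReal ?_
  rw [Real.rpow_neg (by positivity), Real.rpow_neg (by positivity), ← div_eq_mul_inv,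
    le_div_iff₀ (by positivity), inv_mul_le_iff₀ (by positivity),
    ← Real.mul_rpow (by positivity) (by positivity)]
  refine Real.rpow_le_rpow (by positivity) ?_ hr
  have : |x - a| ≤ |x| + |a| := abs_sub _ _
  nlinarith [mul_nonneg hx ha]

lemma lintegral_powerLawDensity_ne_top {r : ℝ} (hr : 1 < r) :
    ∫⁻ x, powerLawDensity r x ≠ ∞ := by
  have h := integrable_one_add_norm (E := ℝ) (μ := volume) (r := r) (by simpa using hr)
  have := h.lintegral_lt_top
  exact this.ne

lemma lintegral_powerLawDensity_ne_zero (r : ℝ) : ∫⁻ x, powerLawDensity r x ≠ 0 := by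
  intro h
  rw [lintegral_eq_zero_iff (measurable_powerLawDensity r)] at h
  have : ∀ᵐ x : ℝ, False := by
    filter_upwards [h] with x hx
    have : 0 < (1 + |x|) ^ (-r) := by positivity
    simp only [powerLawDensity, Pi.zero_apply, ENNReal.ofReal_eq_zero] at hx
    linarith
  simp [ae_iff] at this

/-- The probability measure with density proportional to `(1 + |x|) ^ (-r)`. -/
noncomputable def powerLaw (r : ℝ) : Measure ℝ :=
  (∫⁻ x, powerLawDensity r x)⁻¹ • volume.withDensity (powerLawDensity r)

lemma isProbabilityMeasure_powerLaw {r : ℝ} (hr : 1 < r) : IsProbabilityMeasure (powerLaw r) := by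
  refine ⟨?_⟩
  rw [powerLaw, Measure.smul_apply, withDensity_apply _ .univ, Measure.restrict_univ, smul_eq_mul]
  exact ENNReal.inv_mul_cancel (lintegral_powerLawDensity_ne_zero r)
    (lintegral_powerLawDensity_ne_top hr)

lemma powerLaw_le_shift {r : ℝ} (hr : 0 ≤ r) (a : ℝ) :
    powerLaw r ≤ ENNReal.ofReal ((1 + |a|) ^ r) • shift a (powerLaw r) := by
  have h : volume.withDensity (powerLawDensity r) ≤ ENNReal.ofReal ((1 + |a|) ^ r) •
      (volume.withDensity (powerLawDensity r)).map fun z ↦ z + a := by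
    refine Measure.le_iff.2 fun B hB ↦ ?_
    have h1 : (volume.withDensity (powerLawDensity r)).map (fun z ↦ z + a) B
        = ∫⁻ x in B, powerLawDensity r (x - a) := by
      rw [Measure.map_apply (measurable_add_const a) hB,
        withDensity_apply _ (measurable_add_const a hB), ← lintegral_indicator hB,
        ← lintegral_indicator (measurable_add_const a hB),
        ← lintegral_add_right_eq_self (B.indicator fun x ↦ powerLawDensity r (x - a)) a]
      refine lintegral_congr fun x ↦ ?_
      by_cases hx : x + a ∈ B <;> simp [Set.indicator, Set.mem_preimage (f := fun x : ℝ ↦ x + a), hx]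
    rw [withDensity_apply _ hB, Measure.smul_apply, h1, smul_eq_mul,
      ← lintegral_const_mul' _ _ ENNReal.ofReal_ne_top]
    exact lintegral_mono fun x ↦ powerLawDensity_le hr a x
  rw [powerLaw, shift, Measure.map_smul, smul_comm]
  gcongr

/-- The exponent `α + 2` leaves decay of order `2` after multiplication by the cost bound. -/
lemma lintegral_cost_powerLaw_ne_top {A α : ℝ} (hA : 0 ≤ A) :
    ∫⁻ x, ENNReal.ofReal (A * (1 + |x|) ^ α) ∂(powerLaw (α + 2)) ≠ ∞ := by
  rw [powerLaw, lintegral_smul_measure, lintegral_withDensity_eq_lintegral_mul _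
    (measurable_powerLawDensity _) (by fun_prop)]
  refine ENNReal.mul_ne_top (by simp [lintegral_powerLawDensity_ne_zero]) ?_
  have h : ∀ x : ℝ, (powerLawDensity (α + 2) * fun x ↦ ENNReal.ofReal (A * (1 + |x|) ^ α)) x
      = ENNReal.ofReal A * powerLawDensity 2 x := fun x ↦ by
    have hx := abs_nonneg x
    rw [Pi.mul_apply, powerLawDensity, powerLawDensity, ← ENNReal.ofReal_mul (by positivity),
      ← ENNReal.ofReal_mul hA, mul_left_comm, ← Real.rpow_add (by positivity)]
    ring_nf
  rw [lintegral_congr h, lintegral_const_mul' _ _ ENNReal.ofReal_ne_top]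
  exact ENNReal.mul_ne_top ENNReal.ofReal_ne_top (lintegral_powerLawDensity_ne_top one_lt_two)

/-- Shrinking a power law by a small factor `b` drives its expected cost to `c 0 = 0`, so any `C >
0` is met. It still has bounded density ratios with its translates: a shift by `a` becomes one by `a
/ b` before scaling. -/
lemma KLStarAdd_ne_top {c : ℝ → ℝ} (hc : IsCostFunction c) (s : ℝ) {C : ℝ} (hC : 0 < C) :
    KLStarAdd s c C ≠ ∞ := by
  obtain ⟨A, α, hA, hα, hcA⟩ := hc.exists_le_rpow
  have hprob := isProbabilityMeasure_powerLaw (r := α + 2) (by linarith)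
  have hcm := hc.continuous.measurable
  have hlim : Filter.Tendsto (fun n : ℕ ↦ ∫⁻ z, ENNReal.ofReal (c (((n : ℝ) + 1)⁻¹ * z))
      ∂(powerLaw (α + 2))) Filter.atTop (nhds (∫⁻ z, 0 ∂(powerLaw (α + 2)))) := by
    refine tendsto_lintegral_of_dominated_convergence
      (fun x ↦ ENNReal.ofReal (A * (1 + |x|) ^ α)) (fun n ↦ by fun_prop)
      (fun n ↦ ae_of_all _ fun x ↦ ENNReal.ofReal_le_ofReal ((hc.monotone_abs _ _ ?_).trans (hcA x)))
      (lintegral_cost_powerLaw_ne_top hA.le) (ae_of_all _ fun x ↦ ?_)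
    · rw [abs_mul, abs_of_nonneg (by positivity)]
      refine mul_le_of_le_one_left (abs_nonneg x) (inv_le_one_of_one_le₀ (by simp))
    · have h1 : Filter.Tendsto (fun n : ℕ ↦ ((n : ℝ) + 1)⁻¹ * x) Filter.atTop (nhds (0 * x)) :=
        (tendsto_inv_atTop_zero.comp (Filter.tendsto_atTop_add_const_right _ _
          tendsto_natCast_atTop_atTop)).mul_const x
      rw [zero_mul] at h1
      have h2 := (hc.continuous.tendsto 0).comp h1
      rw [hc.map_zero] at h2
      rw [← ENNReal.ofReal_zero]
      exact (ENNReal.continuous_ofReal.tendsto 0).comp h2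
  rw [lintegral_zero] at hlim
  obtain ⟨n, hn⟩ := (hlim.eventually_lt_const (ENNReal.ofReal_pos.2 hC)).exists
  set b : ℝ := ((n : ℝ) + 1)⁻¹ with hb
  have hb0 : 0 < b := by positivity
  have hbm : Measurable fun z : ℝ ↦ b * z := measurable_const_mul b
  set P := (powerLaw (α + 2)).map fun z ↦ b * z with hP
  have hPp : IsProbabilityMeasure P := Measure.isProbabilityMeasure_map hbm.aemeasurable
  have hPf : P ∈ feasibleNoise c C :=
    ⟨hPp, by rw [hP, lintegral_map hcm.ennreal_ofReal hbm]; exact hn.le⟩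
  have hle : ∀ a, |a| ≤ s → P ≤ ENNReal.ofReal ((1 + s / b) ^ (α + 2)) • shift a P := by
    intro a ha
    have hsh : shift a P = (shift (a / b) (powerLaw (α + 2))).map fun z ↦ b * z := by
      rw [shift, shift, hP, Measure.map_map (measurable_add_const _) hbm,
        Measure.map_map hbm (measurable_add_const _)]
      congr 1
      funext z
      simp only [Function.comp_apply]
      field_simp
    have h1 := Measure.map_mono (powerLaw_le_shift (r := α + 2) (by linarith) (a / b)) hbm
    rw [Measure.map_smul, ← hsh] at h1
    refine h1.trans ?_
    gcongr
    rw [abs_div, abs_of_pos hb0]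
    gcongr
  obtain ⟨B, hB⟩ := exists_klDiv_le_of_le_smul (α := ℝ)
    (M := ENNReal.ofReal ((1 + s / b) ^ (α + 2))) ENNReal.ofReal_ne_top
  refine ne_top_of_le_ne_top (ENNReal.ofReal_ne_top (r := B))
    ((iInf₂_le P hPf).trans (iSup₂_le fun a ha ↦ ?_))
  have : IsProbabilityMeasure (shift a P) :=
    Measure.isProbabilityMeasure_map (measurable_add_const a).aemeasurable
  exact hB P (shift a P) (hle a ha)

/-! ### Existence of an optimal noise and conclusion -/

lemma exists_noiseObjective_le_KLStar {c : ℝ → ℝ} (hc : IsCostFunction c) (s C : ℝ)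
    (hfin : KLStar s c C ≠ ∞) :
    ∃ P ∈ feasibleNoise c C, noiseObjective s P ≤ KLStar s c C := by
  have hex : ∀ n : ℕ, ∃ κ ∈ feasibleKernels c C,
      kernelObjective s κ ≤ ENNReal.ofReal ((KLStar s c C).toReal + 1 / ((n : ℝ) + 1)) := fun n ↦ by
    have hlt : KLStar s c C < ENNReal.ofReal ((KLStar s c C).toReal + 1 / ((n : ℝ) + 1)) := by
      rw [ENNReal.lt_ofReal_iff_toReal_lt hfin]
      have : (0 : ℝ) < 1 / ((n : ℝ) + 1) := by positivity
      linarith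
    obtain ⟨κ, h⟩ := iInf_lt_iff.1 hlt
    obtain ⟨hκ, h⟩ := iInf_lt_iff.1 h
    exact ⟨κ, hκ, h.le⟩
  choose κ hκ hobj using hex
  have hlim : Filter.Tendsto (fun n : ℕ ↦ (KLStar s c C).toReal + 1 / ((n : ℝ) + 1)) Filter.atTop
      (nhds (KLStar s c C).toReal) := by
    simpa using tendsto_one_div_add_atTop_nhds_zero_nat.const_add (KLStar s c C).toReal
  obtain ⟨P, hP, h⟩ := exists_feasibleNoise_of_kernels hc hκ
    (fun n ↦ add_nonneg ENNReal.toReal_nonneg (by positivity)) hlim hobj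
  exact ⟨P, hP, by rwa [ENNReal.ofReal_toReal hfin] at h⟩

end OptimalMechanism

theorem theorem1 (s C : ℝ) (hs : 0 < s) (hC : 0 < C) (c : ℝ → ℝ)
    (hc : OptimalMechanism.IsCostFunction c) :
    OptimalMechanism.KLStar s c C = OptimalMechanism.KLStarAdd s c C ∧
    (∃ P ∈ OptimalMechanism.feasibleNoise c C,
      OptimalMechanism.noiseObjective s P = OptimalMechanism.KLStar s c C) ∧
    (∀ P ∈ OptimalMechanism.feasibleNoise c C,
      OptimalMechanism.noiseObjective s P = OptimalMechanism.KLStar s c C →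
      P ≪ (volume : Measure ℝ)) := by
  have hle := OptimalMechanism.KLStar_le_KLStarAdd hc s C
  have hfin := ne_top_of_le_ne_top (OptimalMechanism.KLStarAdd_ne_top hc s hC) hle
  obtain ⟨P, hP, hPle⟩ := OptimalMechanism.exists_noiseObjective_le_KLStar hc s C hfin
  have hadd : OptimalMechanism.KLStarAdd s c C ≤ OptimalMechanism.noiseObjective s P :=
    iInf₂_le P hP
  refine ⟨hle.antisymm (hadd.trans hPle), ⟨P, hP, hPle.antisymm (hle.trans hadd)⟩,
    fun Q hQ hobj ↦ ?_⟩
  have := hQ.1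
  refine OptimalMechanism.absolutelyContinuous_volume_of_shift hs fun a ha ↦ ?_
  have h1 : klDiv Q (OptimalMechanism.shift a Q) ≤ OptimalMechanism.KLStar s c C :=
    (le_iSup₂_of_le (f := fun a (_ : |a| ≤ s) ↦ klDiv Q (OptimalMechanism.shift a Q))
      a ha le_rfl).trans hobj.le
  exact (klDiv_ne_top_iff.1 (ne_top_of_le_ne_top hfin h1)).1
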